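/- Let $q\in\mathbb C$ with $|q|<1$, let $a\in\mathbb C$ with $aq^n\neq 1$ for all integers $n\ge 1$, and let $a^{1/2}$ denote a fixed (either) square root of $a$. Write $(z;q)_n=\prod_{j=0}^{n-1}(1-zq^j)$ and $(z;q)_\infty=\prod_{j\ge 0}(1-zq^j)$, with the convention $1/(q;q)_{m}=0$ for $m<0$. Let $k\geq 1$ and $i\in\{1,2,\ldots,k\}$. Then all the series below converge absolutely, and $$ \frac{(-a^{1/2}q;q)_{\infty}}{(aq;q)_{\infty}} \sum_{n=0}^{\infty} (-1)^na^{(k-1/2)n}q^{kn^2 +(k-i)n}\bigl(1-a^iq^{(2n+1)i}\bigr)\frac{(aq;q)_n}{(q;q)_n} $$ $$ =\sum_{s_1,\ldots,s_{2k-2} = 0}^{\infty} \frac{a^{(s_1 + s_2 + \cdots+s_{2k-2})/2}\, q^{(s_1^2+s_2^2 + \cdots + s_{2k-2}^2)/2 + s_{2i} +s_{2i+2} + \cdots + s_{2k-2} + S/2}}{(q;q)_{s_1-s_2} (q;q)_{s_2-s_3} \cdots (q;q)_{s_{2k-3}-s_{2k-2}}(q;q)_{s_{2k-2}}}, $$ where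 $S = s_1-s_2+s_3-s_4 + \cdots + s_{2k-3}-s_{2k-2}$ (for $k=1$ the multisum is the empty multisum, equal to $1$; powers of $a^{1/2}$ are powers of the fixed square root). If moreover $k\ge 2$, both sides are also equal to $$ (-a^{1/2}q;q)_{\infty}\sum_{s_1,\ldots,s_{k-1}=0}^{\infty} \frac{a^{s_1+s_2+\cdots + s_{k-1}}\, q^{s_1^2 + s_2^2 + \cdots +s_{k-1}^2 + s_i + s_{i+1}+\cdots + s_{k-1}}}{(q;q)_{s_1-s_2} (q;q)_{s_2-s_3} \cdots (q;q)_{s_{k-2}-s_{k-1}}(q;q)_{s_{k-1}}\,(-a^{1/2}q;q)_{s_{k-1}}}. $$ Here the sums $s_i+\cdots+s_{k-1}$ and $s_{2i}+s_{2i+2}+\cdots+s_{2k-2}$ are empty, equal to $0$, when $i=k$. -/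

import Mathlib

open Finset

namespace CompanionMelzer

/-- The finite `q`-shifted factorial `(z;q)_n = ∏_{j=0}^{n-1} (1 - z q^j)`. -/
noncomputable def qPoch (z q : ℂ) (n : ℕ) : ℂ :=
  ∏ j ∈ range n, (1 - z * q ^ j)

/-- The infinite `q`-shifted factorial `(z;q)_∞ = ∏_{j≥0} (1 - z q^j)`. -/
noncomputable def qPochInf (z q : ℂ) : ℂ :=
  ∏' j : ℕ, (1 - z * q ^ j)

/-- For `|q| < 1` the infinite product in `qPochInf` converges. -/
theorem multipliable_qPochInf (z q : ℂ) (hq : ‖q‖ < 1) :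
    Multipliable fun j : ℕ => 1 - z * q ^ j := by
  have h : Summable fun j : ℕ => ‖-(z * q ^ j)‖ := by
    simp only [norm_neg, norm_mul, norm_pow]
    exact (summable_geometric_of_lt_one (norm_nonneg q) hq).mul_left _
  simpa [sub_eq_add_neg] using multipliable_one_add_of_summable h

/-- `1 / (q;q)_{m-n}`, with the usual convention that this is `0` when `m < n`. -/
noncomputable def invQQ (q : ℂ) (m n : ℕ) : ℂ :=
  if n ≤ m then 1 / qPoch q q (m - n) else 0

/-- The entry `s_j` (`1 ≤ j ≤ m`) of a vector of summation indices `(s_1, …, s_m)`, numbered from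
`1`; the entries outside this range are `0`. In particular `s_{m+1} = 0`. -/
def ent {m : ℕ} (s : Fin m → ℕ) (j : ℕ) : ℕ :=
  if h : 1 ≤ j ∧ j ≤ m then s ⟨j - 1, by omega⟩ else 0

/-- `1 / ((q;q)_{s_1-s_2} (q;q)_{s_2-s_3} ⋯ (q;q)_{s_{m-1}-s_m} (q;q)_{s_m})`. -/
noncomputable def chainWeight (q : ℂ) {m : ℕ} (s : Fin m → ℕ) : ℂ :=
  ∏ j ∈ Icc 1 m, invQQ q (ent s j) (ent s (j + 1))

/-- The `n`-th term of the single sum,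
`(-1)^n a^{(k-1/2)n} q^{kn²+(k-i)n} (1 - a^i q^{(2n+1)i}) (aq;q)_n / (q;q)_n`,
where `x` stands for `a^{1/2}`. It is used for `1 ≤ i ≤ k` only. -/
noncomputable def singleTerm (a x q : ℂ) (k i n : ℕ) : ℂ :=
  (-1) ^ n * x ^ ((2 * k - 1) * n) * q ^ (k * n ^ 2 + (k - i) * n)
    * (1 - a ^ i * q ^ ((2 * n + 1) * i)) * (qPoch (a * q) q n / qPoch q q n)

/-- The summand of the `(k-1)`-fold sum, where `x` stands for `a^{1/2}`. It is used for `2 ≤ k`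
only. -/
noncomputable def multiTerm (a x q : ℂ) (k i : ℕ) (s : Fin (k - 1) → ℕ) : ℂ :=
  a ^ (∑ j ∈ Icc 1 (k - 1), ent s j)
    * q ^ (∑ j ∈ Icc 1 (k - 1), ent s j ^ 2 + ∑ j ∈ Icc i (k - 1), ent s j)
    * chainWeight q s / qPoch (-x * q) q (ent s (k - 1))

/-- The alternating sum `S = s_1 - s_2 + s_3 - ⋯ ` of all entries. -/
def altSum {m : ℕ} (s : Fin m → ℕ) : ℤ :=
  ∑ j ∈ Icc 1 m, (-1) ^ (j + 1) * (ent s j : ℤ)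

/-- `s_1² + ⋯ + s_m² + S` is even, so that halving it in `ℤ` is exact. -/
theorem two_dvd_sq_add_altSum {m : ℕ} (s : Fin m → ℕ) :
    (2 : ℤ) ∣ ∑ j ∈ Icc 1 m, (ent s j : ℤ) ^ 2 + altSum s := by
  unfold altSum
  rw [← sum_add_distrib]
  refine dvd_sum fun j _ => ?_
  have h := (Int.even_mul_succ_self (ent s j : ℤ)).two_dvd
  have h' := (Int.even_mul_pred_self (ent s j : ℤ)).two_dvd
  rcases neg_one_pow_eq_or ℤ (j + 1) with e | e <;> rw [e]
  · convert h using 1; ring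
  · convert h' using 1; ring

/-- `s_1² + ⋯ + s_m² + S` is nonnegative. -/
theorem sq_add_altSum_nonneg {m : ℕ} (s : Fin m → ℕ) :
    0 ≤ ∑ j ∈ Icc 1 m, (ent s j : ℤ) ^ 2 + altSum s := by
  unfold altSum
  rw [← sum_add_distrib]
  refine sum_nonneg fun j _ => ?_
  have h0 : (0 : ℤ) ≤ (ent s j : ℤ) := Int.natCast_nonneg _
  rcases neg_one_pow_eq_or ℤ (j + 1) with e | e <;> rw [e]
  · positivity
  · rcases h0.eq_or_lt with h | h
    · rw [← h]; norm_num
    · nlinarith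

/-- The exponent `(s_1² + ⋯ + s_{2k-2}²)/2 + s_{2i} + s_{2i+2} + ⋯ + s_{2k-2} + S/2` of `q`; the
two halves together make an integer. -/
def bigExponent (k i : ℕ) (s : Fin (2 * k - 2) → ℕ) : ℤ :=
  (∑ j ∈ Icc 1 (2 * k - 2), (ent s j : ℤ) ^ 2 + altSum s) / 2
    + ∑ j ∈ Icc i (k - 1), (ent s (2 * j) : ℤ)

/-- The summand of the `(2k-2)`-fold sum, where `x` stands for `a^{1/2}`. -/
noncomputable def bigTerm (x q : ℂ) (k i : ℕ) (s : Fin (2 * k - 2) → ℕ) : ℂ :=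
  x ^ (∑ j ∈ Icc 1 (2 * k - 2), ent s j) * q ^ bigExponent k i s * chainWeight q s

end CompanionMelzer

namespace CompanionMelzer

/-! All three expressions come from one Bailey chain. A step sends a sequence β to ∑_r w_r β_r /
(q;q)_{L-r}. By a finite `₁φ₁` summation (`sum_prod_div_qPoch`), the kernels 1/((q;q)_{n-r}
(d;q)_{n+r}) are eigenvectors of the step with weight d^s q^{s(s-1)}. A β expanded in such kernels
therefore keeps its expansion, and only the coefficients are multiplied.

The seed 1/((q;q)_n (-xq;q)_n), with x = a^{1/2}, has such an expansion (`seed_eq_sum`): it comes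
from the unit Bailey pair by one step whose weight involves the square root of the kernel parameter.
In `chainIter_multiWeight` the innermost steps, whose weights carry an extra q^n, act on kernels
with parameter aq². `baileyKernel_sub` turns these into differences of neighbouring kernels with
parameter aq. Each remaining step then multiplies the ratio of the two coefficients by aq^{2r+1},
which produces the factor 1 - a^i q^{(2r+1)i}.

The (2k-2)-fold sum starts from 1/(q;q)_n. Two of its steps collapse into one step of the (k-1)-fold
chain, up to a factor (-xq;q)_L (`qStep_qStep`), so this factor appears once in front
(`chainIter_bigWeight`).

These identities are finite in L. Multiplying by (q;q)_L and letting L → ∞ under dominated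
convergence gives the theorem. -/

theorem qPoch_succ (z q : ℂ) (n : ℕ) : qPoch z q (n + 1) = qPoch z q n * (1 - z * q ^ n) := by
  simp [qPoch, prod_range_succ]

theorem qPoch_add (z q : ℂ) (m n : ℕ) :
    qPoch z q (m + n) = qPoch z q m * qPoch (z * q ^ m) q n := by
  simp only [qPoch, prod_range_add]
  congr 1
  exact prod_congr rfl fun j _ => by ring

theorem qPoch_succ' (z q : ℂ) (n : ℕ) : qPoch z q (n + 1) = (1 - z) * qPoch (z * q) q n := by
  rw [add_comm, qPoch_add]
  simp [qPoch]

theorem qPoch_ne_zero {z q : ℂ} (h : ∀ n : ℕ, z * q ^ n ≠ 1) (n : ℕ) : qPoch z q n ≠ 0 :=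
  prod_ne_zero_iff.2 fun j _ => sub_ne_zero.2 (h j).symm

theorem mul_pow_ne_one_of_norm_lt {q : ℂ} (hq : ‖q‖ < 1) (n : ℕ) : q * q ^ n ≠ 1 := by
  intro h
  have h1 : ‖q ^ (n + 1)‖ = 1 := by rw [pow_succ', h, norm_one]
  rw [norm_pow] at h1
  exact (pow_lt_one₀ (norm_nonneg q) hq n.succ_ne_zero).ne h1

theorem qPoch_self_ne_zero {q : ℂ} (hq : ‖q‖ < 1) (n : ℕ) : qPoch q q n ≠ 0 :=
  qPoch_ne_zero (mul_pow_ne_one_of_norm_lt hq) n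

theorem invQQ_of_lt (q : ℂ) {m n : ℕ} (h : m < n) : invQQ q m n = 0 := by
  simp [invQQ, h.not_ge]

theorem invQQ_zero (q : ℂ) (m : ℕ) : invQQ q m 0 = 1 / qPoch q q m := by simp [invQQ]

theorem invQQ_add (q : ℂ) (m n : ℕ) : invQQ q (m + n) m = 1 / qPoch q q n := by simp [invQQ]

theorem invQQ_succ {q : ℂ} (hq : ‖q‖ < 1) {m n : ℕ} (h : n ≤ m + 1) :
    (1 - q ^ (m + 1 - n)) * invQQ q (m + 1) n = invQQ q m n := by
  rcases h.eq_or_lt with rfl | h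
  · simp [invQQ]
  · obtain ⟨l, rfl⟩ := Nat.exists_eq_add_of_le (Nat.lt_succ_iff.1 h)
    have h1 : 1 - q * q ^ l ≠ 0 := sub_ne_zero.2 (mul_pow_ne_one_of_norm_lt hq l).symm
    rw [invQQ_add, add_assoc, invQQ_add, Nat.add_sub_cancel_left, qPoch_succ]
    have := qPoch_self_ne_zero hq l
    field_simp
    ring

/-! ### A finite `₁φ₁` summation -/

/-- The finite form of Cauchy's `₁φ₁` summation, in which both the numerator and the denominator
parameter may be `0`. -/
theorem sum_prod_div_qPoch {q : ℂ} (hq : ‖q‖ < 1) (e : ℂ) (M : ℕ) :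
    ∀ d : ℂ, (∀ n : ℕ, d * q ^ n ≠ 1) →
      ∑ t ∈ range (M + 1), (∏ j ∈ range t, q ^ j * (d * q ^ j - e)) / qPoch d q t
          * invQQ q M t * invQQ q t 0
        = qPoch e q M / (qPoch d q M * qPoch q q M) := by
  induction M with
  | zero => intro d _; simp [invQQ, qPoch]
  | succ M ih =>
    intro d hd
    have hdq : ∀ n : ℕ, d * q * q ^ n ≠ 1 := fun n => by
      have := hd (n + 1); rwa [pow_succ', ← mul_assoc] at this
    set U : ℂ → ℕ → ℂ := fun d t => ∏ j ∈ range t, q ^ j * (d * q ^ j - e) with hU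
    -- Removing the factor j = 0 replaces d by dq, which is why the induction runs over all d at
    -- once.
    have hU' : ∀ t, U d (t + 1) = (d - e) * q ^ t * U (d * q) t := by
      intro t
      simp only [hU]
      rw [prod_range_succ', prod_mul_distrib, prod_mul_distrib, prod_congr rfl
        (fun j _ => pow_succ q j), prod_mul_distrib, prod_const, card_range, prod_congr rfl
        (fun j _ => show d * q ^ (j + 1) - e = d * q * q ^ j - e by ring)]
      ring
    have key : (1 - q ^ (M + 1)) * ∑ t ∈ range (M + 1 + 1), U d t / qPoch d q t
          * invQQ q (M + 1) t * invQQ q t 0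
        = ∑ t ∈ range (M + 1), U d t / qPoch d q t * invQQ q M t * invQQ q t 0
          + q ^ M * (d - e) / (1 - d) * ∑ t ∈ range (M + 1), U (d * q) t / qPoch (d * q) q t
            * invQQ q M t * invQQ q t 0 := by
      -- The split 1 - q^{M+1} = (1 - q^{M+1-t}) + q^{M+1-t}(1 - q^t): the first part lowers M, the
      -- second lowers t and leads to the sum for dq.
      have h1 : ∀ t ∈ range (M + 1 + 1), (1 - q ^ (M + 1)) * (U d t / qPoch d q t
            * invQQ q (M + 1) t * invQQ q t 0)
          = U d t / qPoch d q t * invQQ q M t * invQQ q t 0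
            + U d t / qPoch d q t * q ^ (M + 1 - t) * invQQ q (M + 1) t
              * ((1 - q ^ t) * invQQ q t 0) := by
        intro t ht
        have ht' : t ≤ M + 1 := Nat.lt_succ_iff.1 (mem_range.1 ht)
        rw [← invQQ_succ hq ht']
        have h2 : q ^ (M + 1) = q ^ (M + 1 - t) * q ^ t := by rw [← pow_add]; congr 1; omega
        rw [h2]; ring
      rw [mul_sum, sum_congr rfl h1, sum_add_distrib]
      congr 1
      · rw [sum_range_succ, invQQ_of_lt q (Nat.lt_succ_self M)]; simp
      · rw [sum_range_succ', mul_sum]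
        simp only [pow_zero, sub_self, zero_mul, mul_zero, add_zero]
        refine sum_congr rfl fun t ht => ?_
        have ht' : t ≤ M := Nat.lt_succ_iff.1 (mem_range.1 ht)
        have h3 := invQQ_succ hq (m := t) (n := 0) (Nat.zero_le _)
        rw [Nat.sub_zero] at h3
        obtain ⟨l, rfl⟩ := Nat.exists_eq_add_of_le ht'
        rw [h3, hU', qPoch_succ', invQQ_add, show t + l + 1 = t + 1 + l by ring, invQQ_add,
          Nat.add_sub_cancel_left]
        have := qPoch_ne_zero hdq t
        have : 1 - d ≠ 0 := by have := hd 0; simp at this; exact sub_ne_zero.2 (Ne.symm this)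
        have := qPoch_self_ne_zero hq l
        field_simp
        ring
    rw [ih d hd, ih (d * q) hdq] at key
    have hM : 1 - q ^ (M + 1) ≠ 0 := by
      have := mul_pow_ne_one_of_norm_lt hq M
      rw [← pow_succ'] at this; exact sub_ne_zero.2 this.symm
    apply mul_left_cancel₀ hM
    rw [key, qPoch_succ e, qPoch_succ q]
    have e1 : qPoch (d * q) q M = qPoch d q (M + 1) / (1 - d) := by
      rw [qPoch_succ', mul_div_cancel_left₀]
      have := hd 0; simp at this; exact sub_ne_zero.2 (Ne.symm this)
    rw [e1, qPoch_succ d]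
    have : 1 - d ≠ 0 := by have := hd 0; simp at this; exact sub_ne_zero.2 (Ne.symm this)
    have := qPoch_ne_zero hd M
    have := qPoch_self_ne_zero hq M
    have hdM : 1 - d * q ^ M ≠ 0 := sub_ne_zero.2 (hd M).symm
    rw [pow_succ'] at hM ⊢
    generalize q ^ M = Z at *
    -- Both factors stay atomic while fractions are cleared; only D has to be expanded in the final
    -- polynomial identity.
    obtain ⟨D, hD⟩ : ∃ D, D = 1 - d * Z := ⟨_, rfl⟩
    obtain ⟨Q, hQ⟩ : ∃ Q, Q = 1 - q * Z := ⟨_, rfl⟩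
    rw [← hD] at hdM ⊢
    rw [← hQ] at hM ⊢
    field_simp
    rw [hD]
    ring

theorem sum_invQQ_mul_invQQ (q : ℂ) (f : ℕ → ℂ) (r M : ℕ) :
    ∑ s ∈ range (r + M + 1), f s * invQQ q (r + M) s * invQQ q s r
      = ∑ t ∈ range (M + 1), f (r + t) * invQQ q M t * invQQ q t 0 := by
  rw [add_assoc, sum_range_add, sum_eq_zero, zero_add]
  · refine sum_congr rfl fun t ht => ?_
    obtain ⟨l, rfl⟩ := Nat.exists_eq_add_of_le (Nat.lt_succ_iff.1 (mem_range.1 ht))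
    rw [← add_assoc, invQQ_add, invQQ_add, invQQ_add, invQQ_zero]
  · intro s hs
    rw [invQQ_of_lt q (mem_range.1 hs), mul_zero]

/-! ### Bailey steps and their kernels -/

/-- One step of a Bailey chain: `β'_L = ∑_{r ≤ L} w_r β_r / (q;q)_{L-r}`. -/
noncomputable def qStep (q : ℂ) (w β : ℕ → ℂ) (L : ℕ) : ℂ :=
  ∑ r ∈ range (L + 1), w r * invQQ q L r * β r

/-- The Bailey kernel `1 / ((q;q)_{n-r} (d;q)_{n+r})`. -/
noncomputable def baileyKernel (q d : ℂ) (n r : ℕ) : ℂ :=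
  invQQ q n r / qPoch d q (n + r)

/-- With s = r + t, one has (d;q)_{s+r} = (d;q)_{2r} (dq^{2r};q)_t, so the sum over t is the `₁φ₁`
sum with denominator parameter dq^{2r}. The hypothesis on w says exactly that the weights supply its
numerator. -/
theorem qStep_baileyKernel_aux {q : ℂ} (hq : ‖q‖ < 1) {d : ℂ} (hd : ∀ n : ℕ, d * q ^ n ≠ 1)
    (e : ℂ) (w : ℕ → ℂ) (r : ℕ)
    (hw : ∀ t, w (r + t) = w r * ∏ j ∈ range t, q ^ j * (d * q ^ (2 * r) * q ^ j - e))
    (L : ℕ) (hrL : r ≤ L) :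
    qStep q w (fun s => baileyKernel q d s r) L
      = w r * qPoch e q (L - r) * baileyKernel q d L r := by
  obtain ⟨M, rfl⟩ := Nat.exists_eq_add_of_le hrL
  have h := sum_prod_div_qPoch hq e M (d * q ^ (2 * r)) fun n => by
    rw [mul_assoc, ← pow_add]; exact hd _
  have h1 := sum_invQQ_mul_invQQ q (fun s => w s / qPoch d q (s + r)) r M
  unfold qStep baileyKernel
  rw [Nat.add_sub_cancel_left, invQQ_add]
  calc _ = ∑ s ∈ range (r + M + 1), w s / qPoch d q (s + r) * invQQ q (r + M) s * invQQ q s r :=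
        sum_congr rfl fun s _ => by ring
    _ = w r / qPoch d q (2 * r) * (qPoch e q M / (qPoch (d * q ^ (2 * r)) q M * qPoch q q M)) := by
        rw [h1, ← h, mul_sum]
        refine sum_congr rfl fun t _ => ?_
        rw [hw, show r + t + r = 2 * r + t by ring, qPoch_add, div_eq_mul_inv, mul_inv]
        ring
    _ = _ := by
        rw [show r + M + r = 2 * r + M by ring, qPoch_add]
        simp only [div_eq_mul_inv, mul_inv, one_mul]
        ring

theorem qStep_of_lt (q : ℂ) (w β : ℕ → ℂ) {L r : ℕ} (h : L < r) (hβ : ∀ s < r, β s = 0) :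
    qStep q w β L = 0 :=
  sum_eq_zero fun s hs => by rw [hβ s (by simp at hs; omega), mul_zero]

theorem baileyKernel_of_lt (q d : ℂ) {n r : ℕ} (h : n < r) : baileyKernel q d n r = 0 := by
  simp [baileyKernel, invQQ_of_lt q h]

theorem prod_range_mul_pow_two_mul (d q : ℂ) (n : ℕ) :
    ∏ j ∈ range n, d * q ^ (2 * j) = d ^ n * q ^ (n * (n - 1)) := by
  rw [prod_mul_distrib, prod_const, card_range, prod_pow_eq_pow_sum, ← mul_sum, mul_comm 2,
    sum_range_id_mul_two]

/-- The case e = 0, in which (e;q)_{L-r} = 1 and the kernel is an eigenvector. -/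
theorem qStep_baileyKernel {q : ℂ} (hq : ‖q‖ < 1) {d : ℂ} (hd : ∀ n : ℕ, d * q ^ n ≠ 1)
    (r L : ℕ) :
    qStep q (fun s => d ^ s * q ^ (s * (s - 1))) (fun s => baileyKernel q d s r) L
      = d ^ r * q ^ (r * (r - 1)) * baileyKernel q d L r := by
  rcases lt_or_ge L r with h | h
  · rw [baileyKernel_of_lt q d h, mul_zero]
    exact qStep_of_lt q _ _ h fun s hs => baileyKernel_of_lt q d hs
  · simp only [← prod_range_mul_pow_two_mul]
    rw [qStep_baileyKernel_aux hq hd 0 _ r _ L h]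
    · simp [qPoch]
    · intro t
      rw [prod_range_add]
      congr 1
      exact prod_congr rfl fun j _ => by rw [sub_zero]; ring

/-- Here e = -yq^r, because yq^{r+j}(1 + yq^{r+j}) = q^j(y²q^{2r}q^j - e). The factors (-y;q)_r and
(-yq^r;q)_{L-r} combine to (-y;q)_L, which does not depend on r. -/
theorem qStep_half_baileyKernel {q : ℂ} (hq : ‖q‖ < 1) {y : ℂ}
    (hy : ∀ n : ℕ, y ^ 2 * q ^ n ≠ 1) (r L : ℕ) :
    qStep q (fun s => (∏ j ∈ range s, y * q ^ j) * qPoch (-y) q s)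
        (fun s => baileyKernel q (y ^ 2) s r) L
      = qPoch (-y) q L * (∏ j ∈ range r, y * q ^ j) * baileyKernel q (y ^ 2) L r := by
  rcases lt_or_ge L r with h | h
  · rw [baileyKernel_of_lt q _ h, mul_zero]
    exact qStep_of_lt q _ _ h fun s hs => baileyKernel_of_lt q _ hs
  · rw [qStep_baileyKernel_aux hq hy (-y * q ^ r) _ r _ L h]
    · obtain ⟨M, rfl⟩ := Nat.exists_eq_add_of_le h
      rw [Nat.add_sub_cancel_left, qPoch_add]
      ring
    · intro t
      rw [prod_range_add, qPoch_add, qPoch, qPoch, mul_mul_mul_comm, ← prod_mul_distrib (s := range t)]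
      congr 1
      exact prod_congr rfl fun j _ => by ring

/-- The unit Bailey pair. -/
theorem unit_bailey_pair {q : ℂ} (hq : ‖q‖ < 1) {b : ℂ} (hb : ∀ n : ℕ, b * q ^ n ≠ 1) (n : ℕ) :
    ∑ r ∈ range (n + 1), (-1) ^ r * (∏ j ∈ range r, q ^ j) * (1 - b * q ^ (2 * r)) * qPoch b q r
        / qPoch q q r * (invQQ q n r / qPoch b q (n + r + 1))
      = if n = 0 then 1 else 0 := by
  rcases Nat.eq_zero_or_pos n with rfl | hn
  · have : 1 - b ≠ 0 := by have := hb 0; simp at this; exact sub_ne_zero.2 (Ne.symm this)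
    simp [qPoch, invQQ, this]
  obtain ⟨N, rfl⟩ : ∃ N, n = N + 1 := ⟨n - 1, by omega⟩
  rw [if_neg (by omega)]
  -- The summand telescopes: it is G(r+1) - G(r). G vanishes at r = 0 because of 1 - q^r, and at r =
  -- N + 2 because of the convention for `invQQ`.
  set G : ℕ → ℂ := fun r => -((-1) ^ r * (∏ j ∈ range r, q ^ j) * qPoch b q r * (1 - q ^ r)
    / (qPoch q q r * qPoch b q (N + 1 + r) * (1 - q ^ (N + 1)))) * invQQ q (N + 1) r with hG
  have hN : 1 - q ^ (N + 1) ≠ 0 := by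
    have := mul_pow_ne_one_of_norm_lt hq N
    rw [← pow_succ'] at this; exact sub_ne_zero.2 this.symm
  have key : ∀ r ∈ range (N + 1 + 1), (-1) ^ r * (∏ j ∈ range r, q ^ j) * (1 - b * q ^ (2 * r))
      * qPoch b q r / qPoch q q r * (invQQ q (N + 1) r / qPoch b q (N + 1 + r + 1))
      = G (r + 1) - G r := by
    intro r hr
    have hr' : r ≤ N + 1 := Nat.lt_succ_iff.1 (mem_range.1 hr)
    have e1 : invQQ q (N + 1) (r + 1) = (1 - q ^ (N + 1 - r)) * invQQ q (N + 1) r := by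
      rw [invQQ_succ hq hr']
      simp [invQQ]
    have e2 : q ^ (N + 1) = q ^ (N + 1 - r) * q ^ r := by rw [← pow_add]; congr 1; omega
    have e3 : qPoch b q (N + 1 + r + 1) = qPoch b q (N + 1 + r) * (1 - b * q ^ (N + 1 - r) * q ^ (2 * r)) := by
      rw [qPoch_succ, pow_add, e2]; ring
    have h3 : 1 - b * q ^ (N + 1 - r) * q ^ (2 * r) ≠ 0 := by
      rw [mul_assoc, ← pow_add]; exact sub_ne_zero.2 (hb _).symm
    have h4 : qPoch q q (r + 1) = qPoch q q r * (1 - q ^ (r + 1)) := by rw [qPoch_succ]; ring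
    have h5 : 1 - q ^ (r + 1) ≠ 0 := by
      have := mul_pow_ne_one_of_norm_lt hq r
      rw [← pow_succ'] at this; exact sub_ne_zero.2 this.symm
    have h6 := qPoch_ne_zero hb (N + 1 + r)
    have h7 := qPoch_self_ne_zero hq r
    simp only [hG]
    rw [e1, ← add_assoc, e3, h4, qPoch_succ b q r, prod_range_succ]
    rw [e2] at hN ⊢
    generalize q ^ (N + 1 - r) = Y at *
    rw [pow_mul' q 2 r] at *
    generalize qPoch b q (N + 1 + r) = Z at *
    generalize invQQ q (N + 1) r = I at *
    rw [pow_succ q r] at h5 ⊢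
    generalize q ^ r = V at *
    generalize (∏ j ∈ range r, q ^ j) = P at *
    obtain ⟨D, hD⟩ : ∃ D, D = 1 - b * Y * V ^ 2 := ⟨_, rfl⟩
    obtain ⟨Q, hQ⟩ : ∃ Q, Q = 1 - Y * V := ⟨_, rfl⟩
    obtain ⟨R, hR⟩ : ∃ R, R = 1 - V * q := ⟨_, rfl⟩
    rw [← hD] at h3 ⊢
    rw [← hQ] at hN ⊢
    rw [← hR] at h5 ⊢
    field_simp
    rw [hD, hQ]
    ring
  rw [sum_congr rfl key, sum_range_sub]
  simp [hG, invQQ_of_lt]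

/-! ### Iterating the chain on the seed -/

/-- The `m`-fold sum obtained from the sequence `β` by `m` Bailey chain steps, the outermost one
with weight `w 0` and the innermost one with weight `w (m - 1)`. -/
noncomputable def chainIter (q : ℂ) (β : ℕ → ℂ) : ℕ → (ℕ → ℕ → ℂ) → ℕ → ℂ
  | 0, _ => β
  | m + 1, w => qStep q (w 0) (chainIter q β m fun j => w (j + 1))

theorem qStep_congr (q : ℂ) {w w' β β' : ℕ → ℂ} {L : ℕ}
    (h : ∀ r ≤ L, w r * β r = w' r * β' r) : qStep q w β L = qStep q w' β' L :=
  sum_congr rfl fun r hr => by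
    rw [mul_right_comm, h r (Nat.lt_succ_iff.1 (mem_range.1 hr)), mul_right_comm]

/-- Interchange of summation; triangularity of K lets every inner sum be extended to r ≤ L. -/
theorem qStep_sum_kernel (q : ℂ) (w β α : ℕ → ℂ) (K : ℕ → ℕ → ℂ) (hK : ∀ s r, s < r → K s r = 0)
    (hβ : ∀ s, β s = ∑ r ∈ range (s + 1), α r * K s r) (L : ℕ) :
    qStep q w β L = ∑ r ∈ range (L + 1), α r * qStep q w (fun s => K s r) L := by
  have h : ∀ s ∈ range (L + 1), w s * invQQ q L s * β s
      = ∑ r ∈ range (L + 1), w s * invQQ q L s * (α r * K s r) := by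
    intro s hs
    rw [hβ, mul_sum]
    refine sum_subset (fun r hr => ?_) fun r _ hr => ?_
    · simp at hs hr ⊢; omega
    · rw [hK s r (by simp at hr; omega)]; simp
  rw [qStep, sum_congr rfl h, sum_comm]
  refine sum_congr rfl fun r _ => ?_
  rw [qStep, mul_sum]
  exact sum_congr rfl fun s _ => by ring

theorem prod_range_pow_eq_choose (q : ℂ) (n : ℕ) : ∏ j ∈ range n, q ^ j = q ^ n.choose 2 := by
  rw [prod_pow_eq_pow_sum, sum_range_id, Nat.choose_two_right]

theorem choose_two_add_choose_two_add (n : ℕ) : n.choose 2 + n.choose 2 + n = n ^ 2 := by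
  induction n with
  | zero => rfl
  | succ n ih =>
    rw [Nat.choose_succ_succ' n 1, Nat.choose_one_right]
    nlinarith

/-- This changes the parameter: the right side is, up to 1/(1-d), a kernel with parameter dq. It
rests on (1 - dq^{n+r}) - dq^{2r}(1 - q^{n-r}) = 1 - dq^{2r}. -/
theorem baileyKernel_sub {q : ℂ} (hq : ‖q‖ < 1) {d : ℂ} (hd : ∀ n : ℕ, d * q ^ n ≠ 1)
    (n r : ℕ) :
    baileyKernel q d n r - d * q ^ (2 * r) * baileyKernel q d n (r + 1)
      = (1 - d * q ^ (2 * r)) * (invQQ q n r / qPoch d q (n + r + 1)) := by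
  unfold baileyKernel
  rcases lt_or_ge n r with h | h
  · rw [invQQ_of_lt q h, invQQ_of_lt q (h.trans (Nat.lt_succ_self r))]; simp
  · have e1 : invQQ q n (r + 1) = (1 - q ^ (n - r)) * invQQ q n r := by
      have h1 := invQQ_succ hq (m := n) (n := r + 1) (by omega)
      have h2 : invQQ q (n + 1) (r + 1) = invQQ q n r := by simp [invQQ]
      rw [← h1, h2]; congr 3; omega
    obtain ⟨l, rfl⟩ := Nat.exists_eq_add_of_le h
    rw [e1, ← add_assoc, qPoch_succ, Nat.add_sub_cancel_left]
    have h1 : 1 - d * q ^ (r + l + r) ≠ 0 := sub_ne_zero.2 (hd _).symm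
    have h2 := qPoch_ne_zero hd (r + l + r)
    have h3 : q ^ (r + l + r) = q ^ (2 * r) * q ^ l := by rw [← pow_add]; congr 1; ring
    generalize qPoch d q (r + l + r) = Z at *
    generalize invQQ q (r + l) r = I at *
    rw [h3] at h1 ⊢
    generalize q ^ (2 * r) = V at *
    generalize q ^ l = Y at *
    obtain ⟨D, hD⟩ : ∃ D, D = 1 - d * (V * Y) := ⟨_, rfl⟩
    rw [← hD] at h1 ⊢
    field_simp
    rw [hD]
    ring

/-- The seed `1 / ((q;q)_n (-xq;q)_n)` of the multisum. -/
noncomputable def seed (x q : ℂ) (n : ℕ) : ℂ := 1 / qPoch q q n * (1 / qPoch (-x * q) q n)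

/-- The coefficients `(-1)^r x^r q^{r²} (aq;q)_r / (q;q)_r`. -/
noncomputable def seedCoeff (a x q : ℂ) (r : ℕ) : ℂ :=
  (-1) ^ r * x ^ r * q ^ r ^ 2 * (qPoch (a * q) q r / qPoch q q r)

theorem neg_mul_pow_ne_one {a x q : ℂ} (hx : x ^ 2 = a) (ha : ∀ n : ℕ, 1 ≤ n → a * q ^ n ≠ 1)
    (n : ℕ) : -x * q * q ^ n ≠ 1 := by
  intro h
  apply ha (2 * (n + 1)) (by omega)
  have h2 : a * q ^ (2 * (n + 1)) = (-x * q * q ^ n) ^ 2 := by rw [← hx]; ring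
  rw [h2, h, one_pow]

theorem mul_mul_pow_ne_one {a q : ℂ} (ha : ∀ n : ℕ, 1 ≤ n → a * q ^ n ≠ 1) {l : ℕ} (hl : 1 ≤ l)
    (n : ℕ) : a * q ^ l * q ^ n ≠ 1 := by
  rw [mul_assoc, ← pow_add]; exact ha _ (by omega)

theorem inv_qPoch_succ {a q : ℂ} (n : ℕ) :
    1 / qPoch (a * q) q (n + 1) = 1 / (1 - a * q) * (1 / qPoch (a * q ^ 2) q n) := by
  rw [qPoch_succ', mul_assoc a q q, ← pow_two]
  simp only [div_eq_mul_inv, mul_inv, one_mul]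

/-- The half step with y = xq, applied to the unit Bailey pair for b = aq, returns 1/(q;q)_L since β
is concentrated at 0. Dividing by the factor (-xq;q)_L gives the seed. -/
theorem seed_eq_sum {a x q : ℂ} (hx : x ^ 2 = a) (hq : ‖q‖ < 1)
    (ha : ∀ n : ℕ, 1 ≤ n → a * q ^ n ≠ 1) (L : ℕ) :
    seed x q L = ∑ r ∈ range (L + 1), seedCoeff a x q r * ((1 - a * q * q ^ (2 * r))
      * (invQQ q L r / qPoch (a * q) q (L + r + 1))) := by
  have hy : (x * q) ^ 2 = a * q ^ 2 := by rw [← hx]; ring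
  have haq : ∀ n : ℕ, a * q * q ^ n ≠ 1 := by
    simpa using mul_mul_pow_ne_one ha (le_refl 1)
  have hd : ∀ n : ℕ, (x * q) ^ 2 * q ^ n ≠ 1 := by
    rw [hy]; exact mul_mul_pow_ne_one ha one_le_two
  have hK : ∀ L r, invQQ q L r / qPoch (a * q) q (L + r + 1)
      = 1 / (1 - a * q) * baileyKernel q ((x * q) ^ 2) L r := by
    intro L r
    rw [div_eq_mul_one_div, inv_qPoch_succ, baileyKernel, hy]
    ring
  have h := qStep_sum_kernel q (fun s => (∏ j ∈ range s, x * q * q ^ j) * qPoch (-(x * q)) q s)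
    (fun s => if s = 0 then 1 else 0)
    (fun r => (-1) ^ r * (∏ j ∈ range r, q ^ j) * (1 - a * q * q ^ (2 * r)) * qPoch (a * q) q r
        / qPoch q q r * (1 / (1 - a * q))) (baileyKernel q ((x * q) ^ 2))
    (fun s r hsr => baileyKernel_of_lt q _ hsr)
    (fun s => by
      rw [← unit_bailey_pair hq haq s]
      exact sum_congr rfl fun r _ => by rw [hK]; ring) L
  have h1 : qStep q (fun s => (∏ j ∈ range s, x * q * q ^ j) * qPoch (-(x * q)) q s)
    (fun s => if s = 0 then 1 else 0) L = 1 / qPoch q q L := by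
    rw [qStep, sum_eq_single 0]
    · simp [qPoch, invQQ]
    · intro r _ hr; simp [hr]
    · simp
  have h0 := qPoch_ne_zero (neg_mul_pow_ne_one hx ha) L
  rw [seed, ← h1, h, sum_mul]
  refine sum_congr rfl fun r _ => ?_
  rw [qStep_half_baileyKernel hq hd, hK, seedCoeff, ← neg_mul, prod_mul_distrib, prod_const,
    card_range, prod_range_pow_eq_choose, ← choose_two_add_choose_two_add r]
  generalize qPoch (-x * q) q L = Z at *
  calc _ = (-1) ^ r * q ^ r.choose 2 * (1 - a * q * q ^ (2 * r)) * qPoch (a * q) q r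
        / qPoch q q r * (1 / (1 - a * q)) * ((x * q) ^ r * q ^ r.choose 2)
        * baileyKernel q ((x * q) ^ 2) L r * (Z * (1 / Z)) := by ring
    _ = _ := by rw [mul_one_div_cancel h0, mul_pow]; ring

/-- The weights of the `(k-1)`-fold sum, outermost first. -/
noncomputable def multiWeight (a q : ℂ) (e j n : ℕ) : ℂ :=
  a ^ n * q ^ n ^ 2 * if e ≤ j then q ^ n else 1

theorem qStep_shift {q : ℂ} (hq : ‖q‖ < 1) {b : ℂ} (hb : ∀ n : ℕ, b * q * q ^ n ≠ 1) (r L : ℕ) :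
    qStep q (fun n => b ^ n * q ^ n ^ 2) (fun s => baileyKernel q (b * q) s r) L
      = b ^ r * q ^ r ^ 2 * baileyKernel q (b * q) L r := by
  have h : ∀ n : ℕ, b ^ n * q ^ n ^ 2 = (b * q) ^ n * q ^ (n * (n - 1)) := by
    intro n
    rw [mul_pow, mul_assoc, ← pow_add]
    congr 2
    cases n with
    | zero => rfl
    | succ n => rw [Nat.add_sub_cancel]; ring
  simp only [h]
  exact qStep_baileyKernel hq hb r L

/-- Induction from the inside out. While e = 0 the bracket is a multiple of a kernel with parameter
aq², an eigenvector for the weight (aq)^n q^{n²}. Afterwards the weight is a^n q^{n²}, and its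
eigenvalues at r + 1 and r have quotient aq^{2r+1}, which raises the power by one. -/
theorem chainIter_multiWeight {a x q : ℂ} (hx : x ^ 2 = a) (hq : ‖q‖ < 1)
    (ha : ∀ n : ℕ, 1 ≤ n → a * q ^ n ≠ 1) (m : ℕ) : ∀ e ≤ m, ∀ L,
    chainIter q (seed x q) m (multiWeight a q e) L
      = ∑ r ∈ range (L + 1), seedCoeff a x q r * (a ^ (m * r) * q ^ (m * r ^ 2 + (m - e) * r))
        * (baileyKernel q (a * q) L r
          - (a * q ^ (2 * r + 1)) ^ (e + 1) * baileyKernel q (a * q) L (r + 1)) := by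
  have haq : ∀ n : ℕ, a * q * q ^ n ≠ 1 := by
    simpa using mul_mul_pow_ne_one ha (le_refl 1)
  have haq2 : ∀ n : ℕ, a * q * q * q ^ n ≠ 1 := by
    intro n; rw [mul_assoc a q q, ← pow_two]; exact mul_mul_pow_ne_one ha one_le_two n
  have hsub : ∀ L r, baileyKernel q (a * q) L r
      - a * q ^ (2 * r + 1) * baileyKernel q (a * q) L (r + 1)
      = (1 - a * q * q ^ (2 * r)) * (invQQ q L r / qPoch (a * q) q (L + r + 1)) := by
    intro L r
    rw [← baileyKernel_sub hq haq]; ring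
  have hK : ∀ L r, invQQ q L r / qPoch (a * q) q (L + r + 1)
      = 1 / (1 - a * q) * baileyKernel q (a * q * q) L r := by
    intro L r
    rw [div_eq_mul_one_div, inv_qPoch_succ, baileyKernel, mul_assoc a q q, ← pow_two]
    ring
  induction m with
  | zero =>
    intro e he L
    obtain rfl : e = 0 := by omega
    rw [chainIter, seed_eq_sum hx hq ha]
    refine sum_congr rfl fun r _ => ?_
    rw [zero_add, pow_one, hsub]; simp
  | succ m ih =>
    intro e he L
    rw [chainIter]
    rcases e with _ | e
    · rw [qStep_sum_kernel q _ _ (fun r => seedCoeff a x q r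
        * (a ^ (m * r) * q ^ (m * r ^ 2 + (m - 0) * r)) * ((1 - a * q * q ^ (2 * r))
          * (1 / (1 - a * q)))) (baileyKernel q (a * q * q))
        (fun s r hsr => baileyKernel_of_lt q _ hsr)]
      · refine sum_congr rfl fun r _ => ?_
        have hw : multiWeight a q 0 0 = fun n => (a * q) ^ n * q ^ n ^ 2 := by
          funext n; simp only [multiWeight, le_refl, if_true, mul_pow]; ring
        rw [hw, qStep_shift hq haq2, zero_add, pow_one, hsub, hK]
        simp only [Nat.sub_zero]
        ring
      · intro s
        have hw : (fun j => multiWeight a q 0 (j + 1)) = multiWeight a q 0 := by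
          funext j n; simp [multiWeight]
        rw [hw, ih 0 (Nat.zero_le _)]
        refine sum_congr rfl fun r _ => ?_
        rw [zero_add, pow_one, hsub, hK]; ring
    · have hw : (fun j => multiWeight a q (e + 1) (j + 1)) = multiWeight a q e := by
          funext j n; simp [multiWeight]
      rw [hw, qStep_sum_kernel q _ _ (fun r => seedCoeff a x q r
        * (a ^ (m * r) * q ^ (m * r ^ 2 + (m - e) * r))) (fun L r => baileyKernel q (a * q) L r
          - (a * q ^ (2 * r + 1)) ^ (e + 1) * baileyKernel q (a * q) L (r + 1)) _ (ih e (by omega))]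
      · refine sum_congr rfl fun r _ => ?_
        have hw0 : multiWeight a q (e + 1) 0 = fun n => a ^ n * q ^ n ^ 2 := by
          funext n; simp [multiWeight]
        have hlin : qStep q (multiWeight a q (e + 1) 0) (fun L => baileyKernel q (a * q) L r
            - (a * q ^ (2 * r + 1)) ^ (e + 1) * baileyKernel q (a * q) L (r + 1)) L
            = qStep q (multiWeight a q (e + 1) 0) (fun L => baileyKernel q (a * q) L r) L
              - (a * q ^ (2 * r + 1)) ^ (e + 1) * qStep q (multiWeight a q (e + 1) 0)
                (fun L => baileyKernel q (a * q) L (r + 1)) L := by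
          rw [qStep, qStep, qStep, mul_sum, ← sum_sub_distrib]
          exact sum_congr rfl fun s _ => by ring
        rw [hlin, hw0, qStep_shift hq haq, qStep_shift hq haq, Nat.add_sub_add_right]
        ring
      · intro s r hsr
        rw [baileyKernel_of_lt q _ hsr, baileyKernel_of_lt q _ (hsr.trans (Nat.lt_succ_self r))]
        simp

/-! ### Collapsing pairs of steps -/

/-- The weights of the `(2k-2)`-fold sum, outermost first. -/
noncomputable def bigWeight (x q : ℂ) (e j n : ℕ) : ℂ :=
  if Even j then x ^ n * q ^ (n.choose 2 + n)
  else x ^ n * q ^ n.choose 2 * if 2 * e ≤ j then q ^ n else 1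

/-- The same `₁φ₁` sum with d = 0, where the kernel reduces to `invQQ`, and e = -xq^{r+1}. -/
theorem qStep_invQQ {q : ℂ} (hq : ‖q‖ < 1) (x : ℂ) (r L : ℕ) :
    qStep q (fun n => x ^ n * q ^ (n.choose 2 + n)) (fun s => invQQ q s r) L * qPoch (-x * q) q r
      = x ^ r * q ^ (r.choose 2 + r) * qPoch (-x * q) q L * invQQ q L r := by
  rcases lt_or_ge L r with h | h
  · rw [invQQ_of_lt q h, mul_zero, qStep_of_lt q _ _ h fun s hs => invQQ_of_lt q hs, zero_mul]
  · have hw : ∀ n : ℕ, x ^ n * q ^ (n.choose 2 + n) = ∏ j ∈ range n, x * q * q ^ j := by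
      intro n
      rw [prod_mul_distrib, prod_const, card_range, prod_range_pow_eq_choose]; ring
    have hK : ∀ s, invQQ q s r = baileyKernel q 0 s r := fun s => by simp [baileyKernel, qPoch]
    simp only [hw, hK]
    rw [qStep_baileyKernel_aux hq (by simp) (-x * q * q ^ r) _ r _ L h]
    · obtain ⟨M, rfl⟩ := Nat.exists_eq_add_of_le h
      rw [Nat.add_sub_cancel_left, qPoch_add]
      ring
    · intro t
      rw [prod_range_add]
      congr 1
      exact prod_congr rfl fun j _ => by ring

/-- After interchanging sums the middle index is summed by `qStep_invQQ`. The factor (-xq;q)_n on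
the input is what that sum needs, and (-xq;q)_L reappears on the output, so the collapse can be
iterated. -/
theorem qStep_qStep {q : ℂ} (hq : ‖q‖ < 1) (x : ℂ) (c β : ℕ → ℂ) (L : ℕ) :
    qStep q (fun n => x ^ n * q ^ (n.choose 2 + n))
        (qStep q (fun n => x ^ n * q ^ n.choose 2 * c n) fun n => qPoch (-x * q) q n * β n) L
      = qPoch (-x * q) q L * qStep q (fun n => (x ^ 2) ^ n * q ^ n ^ 2 * c n) β L := by
  rw [qStep_sum_kernel q _ (qStep q (fun n => x ^ n * q ^ n.choose 2 * c n)
      fun n => qPoch (-x * q) q n * β n)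
    (fun n => x ^ n * q ^ n.choose 2 * c n * (qPoch (-x * q) q n * β n))
    (invQQ q) (fun s r h => invQQ_of_lt q h)
    (fun s => sum_congr rfl fun r _ => by ring), qStep, mul_sum]
  refine sum_congr rfl fun r _ => ?_
  calc _ = x ^ r * q ^ r.choose 2 * c r * β r * (qStep q (fun n => x ^ n * q ^ (n.choose 2 + n))
        (fun s => invQQ q s r) L * qPoch (-x * q) q r) := by ring
    _ = _ := by
      rw [qStep_invQQ hq, ← choose_two_add_choose_two_add r]
      ring

theorem chainIter_bigWeight {a x q : ℂ} (hx : x ^ 2 = a) (hq : ‖q‖ < 1)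
    (ha : ∀ n : ℕ, 1 ≤ n → a * q ^ n ≠ 1) (p : ℕ) : ∀ e L,
    chainIter q (fun n => 1 / qPoch q q n) (2 * p) (bigWeight x q e) L
      = qPoch (-x * q) q L * chainIter q (seed x q) p (multiWeight a q e) L := by
  induction p with
  | zero =>
    intro e L
    have := qPoch_ne_zero (neg_mul_pow_ne_one hx ha) L
    simp only [chainIter, seed]
    rw [mul_left_comm, mul_one_div_cancel this, mul_one]
  | succ p ih =>
    intro e L
    have h1 : bigWeight x q e 0 = fun n => x ^ n * q ^ (n.choose 2 + n) := by
      funext n; simp [bigWeight]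
    have h2 : bigWeight x q e 1
        = fun n => x ^ n * q ^ n.choose 2 * if e ≤ 0 then q ^ n else 1 := by
      funext n
      have : (2 * e ≤ 1) = (e ≤ 0) := by rw [eq_iff_iff]; omega
      simp only [bigWeight, Nat.not_even_one, if_false, this]
    -- Truncated subtraction is harmless: for e = 0 both conditions hold for every j.
    have h3 : (fun j => bigWeight x q e (j + 1 + 1)) = bigWeight x q (e - 1) := by
      funext j n
      have : (2 * e ≤ j + 1 + 1) = (2 * (e - 1) ≤ j) := by rw [eq_iff_iff]; omega
      simp only [bigWeight, add_assoc, Nat.reduceAdd, Nat.even_add, even_two, iff_true, this]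
    have h4 : (fun j => multiWeight a q e (j + 1)) = multiWeight a q (e - 1) := by
      funext j n
      have : (e ≤ j + 1) = (e - 1 ≤ j) := by rw [eq_iff_iff]; omega
      simp only [multiWeight, this]
    rw [show 2 * (p + 1) = 2 * p + 1 + 1 by ring, chainIter, chainIter, chainIter, h1, h2, h3, h4,
      funext (ih (e - 1)), qStep_qStep hq, hx]
    rfl

/-! ### Limits and bounds for L → ∞ -/

open Filter Topology

theorem tendsto_qPoch {q : ℂ} (hq : ‖q‖ < 1) (z : ℂ) :
    Tendsto (qPoch z q) atTop (𝓝 (qPochInf z q)) :=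
  (multipliable_qPochInf z q hq).hasProd.tendsto_prod_nat

theorem qPochInf_ne_zero {q z : ℂ} (hq : ‖q‖ < 1) (hz : ∀ n : ℕ, z * q ^ n ≠ 1) :
    qPochInf z q ≠ 0 := by
  have h : Summable fun j : ℕ => ‖-(z * q ^ j)‖ := by
    simp only [norm_neg, norm_mul, norm_pow]
    exact (summable_geometric_of_lt_one (norm_nonneg q) hq).mul_left _
  have := tprod_one_add_ne_zero_of_summable (f := fun j : ℕ => -(z * q ^ j))
    (fun j => by rw [← sub_eq_add_neg]; exact sub_ne_zero.2 (hz j).symm) h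
  simpa only [qPochInf, sub_eq_add_neg] using this

theorem exists_norm_le_of_tendsto {f : ℕ → ℂ} {l : ℂ} (h : Tendsto f atTop (𝓝 l)) :
    ∃ C, 0 ≤ C ∧ ∀ n, ‖f n‖ ≤ C := by
  obtain ⟨C, hC⟩ := h.norm.bddAbove_range
  exact ⟨C, (norm_nonneg _).trans (hC ⟨0, rfl⟩), fun n => hC ⟨n, rfl⟩⟩

theorem tendsto_one_div_qPoch {q z : ℂ} (hq : ‖q‖ < 1) (hz : ∀ n : ℕ, z * q ^ n ≠ 1) :
    Tendsto (fun n => 1 / qPoch z q n) atTop (𝓝 (1 / qPochInf z q)) :=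
  tendsto_const_nhds.div (tendsto_qPoch hq z) (qPochInf_ne_zero hq hz)

theorem tendsto_qPoch_mul_invQQ {q : ℂ} (hq : ‖q‖ < 1) (n : ℕ) :
    Tendsto (fun L => qPoch q q L * invQQ q L n) atTop (𝓝 1) := by
  have hne := qPochInf_ne_zero hq (mul_pow_ne_one_of_norm_lt hq)
  have h := (tendsto_qPoch hq q).mul ((tendsto_one_div_qPoch hq
    (mul_pow_ne_one_of_norm_lt hq)).comp (tendsto_sub_atTop_nat n))
  rw [mul_one_div_cancel hne] at h
  refine h.congr' ?_
  filter_upwards [eventually_ge_atTop n] with L hL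
  simp [invQQ, hL]

theorem exists_norm_invQQ_le {q : ℂ} (hq : ‖q‖ < 1) :
    ∃ C, 0 ≤ C ∧ ∀ m n, ‖invQQ q m n‖ ≤ C := by
  obtain ⟨C, hC, h⟩ := exists_norm_le_of_tendsto
    (tendsto_one_div_qPoch hq (mul_pow_ne_one_of_norm_lt hq))
  refine ⟨C, hC, fun m n => ?_⟩
  unfold invQQ
  split_ifs
  · exact h _
  · simpa using hC

theorem exists_norm_qPoch_mul_invQQ_le {q : ℂ} (hq : ‖q‖ < 1) :
    ∃ C, 0 ≤ C ∧ ∀ m n, ‖qPoch q q m * invQQ q m n‖ ≤ C := by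
  obtain ⟨C, hC, h⟩ := exists_norm_invQQ_le hq
  obtain ⟨D, hD, h'⟩ := exists_norm_le_of_tendsto (tendsto_qPoch hq q)
  refine ⟨D * C, by positivity, fun m n => ?_⟩
  rw [norm_mul]
  exact mul_le_mul (h' m) (h m n) (norm_nonneg _) hD

/-- The ratio of consecutive terms is yq^n → 0. This series is the source of all majorants below,
with no restriction on the size of y. -/
theorem summable_norm_pow_mul_pow_choose {q : ℂ} (hq : ‖q‖ < 1) (y : ℂ) :
    Summable fun n : ℕ => ‖y ^ n * q ^ n.choose 2‖ := by
  refine (summable_of_ratio_norm_eventually_le (f := fun n : ℕ => y ^ n * q ^ n.choose 2)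
    (r := 1 / 2) (by norm_num) ?_).norm
  have h : Tendsto (fun n : ℕ => ‖y * q ^ n‖) atTop (𝓝 0) := by
    have := (tendsto_pow_atTop_nhds_zero_of_norm_lt_one hq).const_mul y
    rw [mul_zero] at this
    simpa using this.norm
  filter_upwards [h.eventually_le_const (show (0 : ℝ) < 1 / 2 by norm_num)] with n hn
  have e : y ^ (n + 1) * q ^ (n + 1).choose 2 = y * q ^ n * (y ^ n * q ^ n.choose 2) := by
    rw [Nat.choose_succ_succ' n 1, Nat.choose_one_right]; ring
  simp only [e, norm_mul (y * q ^ n)]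
  exact mul_le_mul_of_nonneg_right hn (norm_nonneg _)

/-! ### Chain iterates as multiple series -/

/-- The summand of an iterated sum over chains, with general weights. -/
noncomputable def chainTerm (q : ℂ) (w : ℕ → ℕ → ℂ) {m : ℕ} (s : Fin m → ℕ) : ℂ :=
  (∏ j ∈ range m, w j (ent s (j + 1))) * chainWeight q s

theorem Icc_one_eq_map (m : ℕ) : Icc 1 m = (range m).map (addRightEmbedding 1) := by
  rw [range_eq_Ico, map_add_right_Ico]
  ext j; simp

theorem ent_cons_one {m : ℕ} (r : ℕ) (s : Fin m → ℕ) :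
    ent (Fin.cons r s : Fin (m + 1) → ℕ) 1 = r := by
  simp [ent]

theorem ent_cons_succ {m : ℕ} (r : ℕ) (s : Fin m → ℕ) (j : ℕ) :
    ent (Fin.cons r s : Fin (m + 1) → ℕ) (j + 1 + 1) = ent s (j + 1) := by
  unfold ent
  by_cases h : j + 1 ≤ m
  · rw [dif_pos ⟨by omega, by omega⟩, dif_pos ⟨by omega, h⟩]
    exact Fin.cons_succ (α := fun _ => ℕ) r s ⟨j, h⟩
  · rw [dif_neg (by omega), dif_neg (by omega)]

theorem chainWeight_eq (q : ℂ) {m : ℕ} (s : Fin m → ℕ) :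
    chainWeight q s = ∏ j ∈ range m, invQQ q (ent s (j + 1)) (ent s (j + 1 + 1)) := by
  rw [chainWeight, Icc_one_eq_map, prod_map]; rfl

theorem chainTerm_cons (q : ℂ) (w : ℕ → ℕ → ℂ) {m : ℕ} (r : ℕ) (s : Fin m → ℕ) :
    chainTerm q w (Fin.cons r s : Fin (m + 1) → ℕ)
      = w 0 r * (invQQ q r (ent s 1) * chainTerm q (fun j => w (j + 1)) s) := by
  simp only [chainTerm, chainWeight_eq, prod_range_succ', ent_cons_succ, zero_add, ent_cons_one]
  ring

theorem summable_chainTerm {q : ℂ} (hq : ‖q‖ < 1) (m : ℕ) : ∀ w : ℕ → ℕ → ℂ,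
    (∀ j, Summable fun n => ‖w j n‖) → Summable fun s : Fin m → ℕ => ‖chainTerm q w s‖ := by
  induction m with
  | zero => exact fun _ _ => Summable.of_finite
  | succ m ih =>
    intro w hw
    rw [← (Fin.consEquiv fun _ : Fin (m + 1) => ℕ).summable_iff]
    obtain ⟨C, hC, h⟩ := exists_norm_invQQ_le hq
    have h1 := (Summable.mul_of_nonneg (hw 0) (ih _ fun j => hw (j + 1))
      (fun _ => norm_nonneg _) fun _ => norm_nonneg _).mul_left C
    refine Summable.of_nonneg_of_le (fun _ => norm_nonneg _) (fun p => ?_) h1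
    change ‖chainTerm q w (Fin.cons p.1 p.2 : Fin (m + 1) → ℕ)‖ ≤ _
    rw [chainTerm_cons, norm_mul, norm_mul, mul_left_comm]
    exact mul_le_mul_of_nonneg_right (h _ _) (by positivity)

theorem summable_invQQ_mul_chainTerm {q : ℂ} (hq : ‖q‖ < 1) {m : ℕ} {w : ℕ → ℕ → ℂ}
    (hw : ∀ j, Summable fun n => ‖w j n‖) (L : ℕ) :
    Summable fun s : Fin m → ℕ => invQQ q L (ent s 1) * chainTerm q w s := by
  obtain ⟨C, hC, h⟩ := exists_norm_invQQ_le hq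
  refine Summable.of_norm_bounded ((summable_chainTerm hq m w hw).mul_left C) fun s => ?_
  rw [norm_mul]
  exact mul_le_mul_of_nonneg_right (h _ _) (norm_nonneg _)

theorem chainIter_eq_tsum {q : ℂ} (hq : ‖q‖ < 1) (m : ℕ) : ∀ w : ℕ → ℕ → ℂ,
    (∀ j, Summable fun n => ‖w j n‖) → ∀ L, chainIter q (fun n => 1 / qPoch q q n) m w L
      = ∑' s : Fin m → ℕ, invQQ q L (ent s 1) * chainTerm q w s := by
  induction m with
  | zero =>
    intro w _ L
    rw [tsum_fintype, Fintype.sum_unique]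
    simp [chainIter, chainTerm, chainWeight, ent, invQQ]
  | succ m ih =>
    intro w hw L
    have hs := summable_invQQ_mul_chainTerm hq (m := m + 1) hw L
    rw [← (Fin.consEquiv fun _ : Fin (m + 1) => ℕ).summable_iff] at hs
    rw [← (Fin.consEquiv fun _ : Fin (m + 1) => ℕ).tsum_eq]
    have h1 : ∀ p : ℕ × (Fin m → ℕ), invQQ q L (ent (Fin.consEquiv (fun _ : Fin (m + 1) => ℕ) p) 1)
        * chainTerm q w (Fin.consEquiv (fun _ : Fin (m + 1) => ℕ) p)
        = w 0 p.1 * invQQ q L p.1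
          * (invQQ q p.1 (ent p.2 1) * chainTerm q (fun j => w (j + 1)) p.2) := by
      intro p
      change invQQ q L (ent (Fin.cons p.1 p.2 : Fin (m + 1) → ℕ) 1)
        * chainTerm q w (Fin.cons p.1 p.2 : Fin (m + 1) → ℕ) = _
      rw [chainTerm_cons, ent_cons_one]; ring
    rw [tsum_congr h1, Summable.tsum_prod ((summable_congr h1).1 hs), chainIter, qStep,
      tsum_eq_sum (s := range (L + 1))]
    · refine sum_congr rfl fun r _ => ?_
      simp only [ih _ (fun j => hw (j + 1)), tsum_mul_left]
    · intro r hr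
      have hr' : L < r := by simpa using hr
      simp [invQQ_of_lt q hr']

/-- Dominated convergence: (q;q)_L / (q;q)_{L-s_1} tends to 1 and is bounded uniformly in L and s_1.
-/
theorem tendsto_chainIter {q : ℂ} (hq : ‖q‖ < 1) {m : ℕ} {w : ℕ → ℕ → ℂ}
    (hw : ∀ j, Summable fun n => ‖w j n‖) :
    Tendsto (fun L => qPoch q q L * chainIter q (fun n => 1 / qPoch q q n) m w L) atTop
      (𝓝 (∑' s : Fin m → ℕ, chainTerm q w s)) := by
  obtain ⟨C, hC, h⟩ := exists_norm_qPoch_mul_invQQ_le hq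
  have h1 : ∀ L, qPoch q q L * chainIter q (fun n => 1 / qPoch q q n) m w L
      = ∑' s : Fin m → ℕ, qPoch q q L * invQQ q L (ent s 1) * chainTerm q w s := by
    intro L
    rw [chainIter_eq_tsum hq m w hw, ← tsum_mul_left]
    exact tsum_congr fun s => by ring
  simp only [h1]
  refine tendsto_tsum_of_dominated_convergence ((summable_chainTerm hq m w hw).mul_left C)
    (fun s => ?_) (Eventually.of_forall fun L s => ?_)
  · simpa using (tendsto_qPoch_mul_invQQ hq (ent s 1)).mul_const (chainTerm q w s)
  · rw [norm_mul]
    exact mul_le_mul_of_nonneg_right (h _ _) (norm_nonneg _)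

/-- A factor of the seed can be absorbed into the innermost weight; this puts 1/(-xq;q)_{s_{k-1}}
into the (k-1)-fold summand. -/
theorem chainIter_mul_seed (q : ℂ) (u v : ℕ → ℂ) (m : ℕ) : ∀ (w : ℕ → ℕ → ℂ) (L : ℕ),
    chainIter q (fun n => u n * v n) (m + 1) w L
      = chainIter q u (m + 1) (fun j n => if j = m then w j n * v n else w j n) L := by
  induction m with
  | zero =>
    intro w L
    simp only [chainIter]
    exact qStep_congr q fun r _ => by simp; ring
  | succ m ih =>
    intro w L
    change qStep q _ (chainIter q (fun n => u n * v n) (m + 1) _) L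
      = qStep q _ (chainIter q u (m + 1) _) L
    refine qStep_congr q fun r _ => ?_
    rw [ih]
    simp

/-! ### The single sum -/

/-- Splits off one q^{r(r-1)/2} for the majorant; the remaining factor is bounded in r. -/
theorem seedCoeff_mul_eq {a x : ℂ} (hx : x ^ 2 = a) (q : ℂ) (m e r : ℕ) :
    seedCoeff a x q r * (a ^ (m * r) * q ^ (m * r ^ 2 + (m - e) * r))
      = (x ^ (2 * m + 1)) ^ r * q ^ r.choose 2 * ((-1) ^ r
        * q ^ (r.choose 2 + r + (m * r ^ 2 + (m - e) * r))
        * (qPoch (a * q) q r * (1 / qPoch q q r))) := by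
  rw [seedCoeff, ← choose_two_add_choose_two_add r, ← hx]
  ring

theorem summable_seedCoeff_mul {a x q : ℂ} (hx : x ^ 2 = a) (hq : ‖q‖ < 1) (m e : ℕ) :
    Summable fun r => ‖seedCoeff a x q r * (a ^ (m * r) * q ^ (m * r ^ 2 + (m - e) * r))‖ := by
  obtain ⟨C, hC, h⟩ := exists_norm_le_of_tendsto ((tendsto_qPoch hq (a * q)).mul
    (tendsto_one_div_qPoch hq (mul_pow_ne_one_of_norm_lt hq)))
  refine Summable.of_nonneg_of_le (fun _ => norm_nonneg _) (fun r => ?_)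
    ((summable_norm_pow_mul_pow_choose hq (x ^ (2 * m + 1))).mul_right C)
  rw [seedCoeff_mul_eq hx, norm_mul]
  refine mul_le_mul_of_nonneg_left ?_ (norm_nonneg _)
  rw [norm_mul, norm_mul, norm_pow, norm_neg, norm_one, one_pow, one_mul, norm_pow]
  exact (mul_le_of_le_one_left (norm_nonneg _) (pow_le_one₀ (norm_nonneg _) hq.le)).trans (h r)

theorem singleTerm_eq {a x : ℂ} (hx : x ^ 2 = a) (q : ℂ) (m e r : ℕ) :
    singleTerm a x q (m + 1) (e + 1) r
      = seedCoeff a x q r * (a ^ (m * r) * q ^ (m * r ^ 2 + (m - e) * r))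
        * (1 - (a * q ^ (2 * r + 1)) ^ (e + 1)) := by
  rw [singleTerm, seedCoeff, Nat.add_sub_add_right, mul_pow, ← pow_mul,
    show 2 * (m + 1) - 1 = 2 * m + 1 by omega, ← hx]
  ring

theorem norm_pow_mul_le (a : ℂ) {q : ℂ} (hq : ‖q‖ < 1) (r e : ℕ) :
    ‖(a * q ^ (2 * r + 1)) ^ (e + 1)‖ ≤ ‖a‖ ^ (e + 1) := by
  rw [norm_pow, norm_mul, norm_pow]
  exact pow_le_pow_left₀ (by positivity)
    (mul_le_of_le_one_right (norm_nonneg _) (pow_le_one₀ (norm_nonneg _) hq.le)) _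

theorem summable_singleTerm {a x q : ℂ} (hx : x ^ 2 = a) (hq : ‖q‖ < 1) (m e : ℕ) :
    Summable (singleTerm a x q (m + 1) (e + 1)) := by
  refine Summable.of_norm_bounded ((summable_seedCoeff_mul hx hq m e).mul_right
    (1 + ‖a‖ ^ (e + 1))) fun r => ?_
  rw [singleTerm_eq hx, norm_mul]
  refine mul_le_mul_of_nonneg_left ((norm_sub_le _ _).trans ?_) (norm_nonneg _)
  rw [norm_one]
  exact add_le_add_right (norm_pow_mul_le a hq r e) 1

theorem tendsto_chainIter_multiWeight {a x q : ℂ} (hx : x ^ 2 = a) (hq : ‖q‖ < 1)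
    (ha : ∀ n : ℕ, 1 ≤ n → a * q ^ n ≠ 1) {m e : ℕ} (he : e ≤ m) :
    Tendsto (fun L => qPoch q q L * chainIter q (seed x q) m (multiWeight a q e) L) atTop
      (𝓝 (1 / qPochInf (a * q) q * ∑' n, singleTerm a x q (m + 1) (e + 1) n)) := by
  have haq : ∀ n : ℕ, a * q * q ^ n ≠ 1 := by
    simpa using mul_mul_pow_ne_one ha (le_refl 1)
  obtain ⟨C, hC, h⟩ := exists_norm_qPoch_mul_invQQ_le hq
  obtain ⟨D, hD, h'⟩ := exists_norm_le_of_tendsto (tendsto_one_div_qPoch hq haq)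
  set A : ℕ → ℂ := fun r => seedCoeff a x q r * (a ^ (m * r) * q ^ (m * r ^ 2 + (m - e) * r))
    with hA
  have hKlim : ∀ r, Tendsto (fun L => qPoch q q L * baileyKernel q (a * q) L r) atTop
      (𝓝 (1 / qPochInf (a * q) q)) := by
    intro r
    have := (tendsto_qPoch_mul_invQQ hq r).mul ((tendsto_one_div_qPoch hq haq).comp
      (tendsto_add_atTop_nat r))
    rw [one_mul] at this
    refine this.congr fun L => ?_
    simp only [Function.comp, baileyKernel]
    ring
  have hKbd : ∀ L r, ‖qPoch q q L * baileyKernel q (a * q) L r‖ ≤ C * D := by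
    intro L r
    rw [baileyKernel, div_eq_mul_one_div, ← mul_assoc, norm_mul]
    exact mul_le_mul (h _ _) (h' _) (norm_nonneg _) hC
  have h1 : ∀ L, qPoch q q L * chainIter q (seed x q) m (multiWeight a q e) L
      = ∑' r, A r * (qPoch q q L * baileyKernel q (a * q) L r
        - (a * q ^ (2 * r + 1)) ^ (e + 1) * (qPoch q q L * baileyKernel q (a * q) L (r + 1))) := by
    intro L
    rw [chainIter_multiWeight hx hq ha m e he, mul_sum, tsum_eq_sum (s := range (L + 1))]
    · exact sum_congr rfl fun r _ => by ring
    · intro r hr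
      have hr' : L < r := by simpa using hr
      rw [baileyKernel_of_lt q _ hr', baileyKernel_of_lt q _ (hr'.trans (Nat.lt_succ_self r))]
      simp
  simp only [h1]
  rw [← tsum_mul_left]
  refine tendsto_tsum_of_dominated_convergence (bound := fun r => ‖A r‖ * (C * D
    + ‖a‖ ^ (e + 1) * (C * D))) ((summable_seedCoeff_mul hx hq m e).mul_right _)
    (fun r => ?_) (Eventually.of_forall fun L r => ?_)
  · have := ((hKlim r).sub ((hKlim (r + 1)).const_mul ((a * q ^ (2 * r + 1)) ^ (e + 1)))).const_mul
      (A r)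
    rw [singleTerm_eq hx]
    convert this using 2
    ring
  · rw [norm_mul]
    refine mul_le_mul_of_nonneg_left ((norm_sub_le _ _).trans ?_) (norm_nonneg _)
    refine add_le_add (hKbd _ _) ?_
    rw [norm_mul]
    exact mul_le_mul (norm_pow_mul_le a hq r e) (hKbd _ _) (norm_nonneg _) (by positivity)

/-! ### Matching the summands with chain weights -/

theorem sum_Icc_one (f : ℕ → ℕ) (m : ℕ) : ∑ j ∈ Icc 1 m, f j = ∑ j ∈ range m, f (j + 1) := by
  rw [Icc_one_eq_map, sum_map]; rfl

theorem sum_Icc_succ (f : ℕ → ℕ) (e m : ℕ) :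
    ∑ j ∈ Icc (e + 1) m, f j = ∑ j ∈ range m, if e ≤ j then f (j + 1) else 0 := by
  have : Icc (e + 1) m = (Icc 1 m).filter (e + 1 ≤ ·) := by ext j; simp; omega
  rw [this, sum_filter, sum_Icc_one]
  simp

theorem prod_multiWeight (a q : ℂ) (e : ℕ) {m : ℕ} (s : Fin m → ℕ) :
    ∏ j ∈ range m, multiWeight a q e j (ent s (j + 1))
      = a ^ (∑ j ∈ Icc 1 m, ent s j)
        * q ^ (∑ j ∈ Icc 1 m, ent s j ^ 2 + ∑ j ∈ Icc (e + 1) m, ent s j) := by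
  rw [sum_Icc_one, sum_Icc_one fun j => ent s j ^ 2, sum_Icc_succ, ← sum_add_distrib,
    ← prod_pow_eq_pow_sum, ← prod_pow_eq_pow_sum, ← prod_mul_distrib]
  refine prod_congr rfl fun j _ => ?_
  rw [multiWeight]
  split_ifs <;> ring

theorem multiTerm_eq (a x q : ℂ) (p e : ℕ) (s : Fin (p + 1) → ℕ) :
    multiTerm a x q (p + 2) (e + 1) s
      = chainTerm q (fun j n => if j = p then multiWeight a q e j n * (1 / qPoch (-x * q) q n)
        else multiWeight a q e j n) s := by
  have h := prod_multiWeight a q e s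
  rw [prod_range_succ] at h
  have h2 : ∏ j ∈ range p, (if j = p then multiWeight a q e j (ent s (j + 1))
      * (1 / qPoch (-x * q) q (ent s (j + 1))) else multiWeight a q e j (ent s (j + 1)))
      = ∏ j ∈ range p, multiWeight a q e j (ent s (j + 1)) :=
    prod_congr rfl fun j hj => if_neg (mem_range.1 hj).ne
  rw [multiTerm, chainTerm, prod_range_succ, h2, if_pos rfl]
  simp only [show p + 2 - 1 = p + 1 from rfl] at h ⊢
  rw [← h]
  ring

theorem sum_range_two_mul (f : ℕ → ℕ) (p : ℕ) :
    ∑ j ∈ range (2 * p), f j = ∑ t ∈ range p, (f (2 * t) + f (2 * t + 1)) := by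
  induction p with
  | zero => rfl
  | succ p ih =>
    rw [show 2 * (p + 1) = 2 * p + 1 + 1 by ring, sum_range_succ, sum_range_succ, ih,
      sum_range_succ]
    ring

/-- Position j counted from 0 is the entry s_{j+1}. For even j the sign in S is +, and (s² + s)/2 =
C(s,2) + s; for odd j it is -, and (s² - s)/2 = C(s,2). -/
theorem bigExponent_eq (k e : ℕ) (s : Fin (2 * k - 2) → ℕ) :
    bigExponent k (e + 1) s = ((∑ j ∈ range (2 * k - 2), ((ent s (j + 1)).choose 2
      + if Even j then ent s (j + 1) else if 2 * e ≤ j then ent s (j + 1) else 0) : ℕ) : ℤ) := by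
  have h1 : ∑ j ∈ Icc 1 (2 * k - 2), (ent s j : ℤ) ^ 2 + altSum s
      = 2 * ((∑ j ∈ range (2 * k - 2), ((ent s (j + 1)).choose 2
        + if Even j then ent s (j + 1) else 0) : ℕ) : ℤ) := by
    rw [altSum, ← sum_add_distrib, Icc_one_eq_map, sum_map, Nat.cast_sum, mul_sum]
    refine sum_congr rfl fun j _ => ?_
    have h2 : ((ent s (j + 1) : ℕ) : ℤ) ^ 2 = (ent s (j + 1)).choose 2 + (ent s (j + 1)).choose 2
        + ent s (j + 1) := by
      exact_mod_cast (choose_two_add_choose_two_add (ent s (j + 1))).symm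
    simp only [addRightEmbedding_apply]
    rw [h2]
    by_cases hj : Even j
    · rw [if_pos hj, add_assoc j, Even.neg_one_pow (hj.add (by decide))]
      push_cast; ring
    · rw [if_neg hj, add_assoc j, Odd.neg_one_pow ((Nat.not_even_iff_odd.1 hj).add_even (by decide))]
      push_cast; ring
  have hk : range (2 * k - 2) = range (2 * (k - 1)) := by congr 1; omega
  rw [bigExponent, h1, Int.mul_ediv_cancel_left _ two_ne_zero, ← Nat.cast_sum, ← Nat.cast_add,
    sum_Icc_succ fun j => ent s (2 * j), hk, sum_range_two_mul, sum_range_two_mul,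
    ← sum_add_distrib]
  congr 1
  refine sum_congr rfl fun t _ => ?_
  have h3 : (2 * e ≤ 2 * t + 1) = (e ≤ t) := by rw [eq_iff_iff]; omega
  have h4 : ¬ Even (2 * t + 1) := by simp
  simp only [even_two_mul, if_true, h4, if_false, h3, mul_add, mul_one, add_assoc, Nat.reduceAdd]
  ring

theorem bigTerm_eq (x q : ℂ) (k e : ℕ) (s : Fin (2 * k - 2) → ℕ) :
    bigTerm x q k (e + 1) s = chainTerm q (bigWeight x q e) s := by
  rw [bigTerm, bigExponent_eq, zpow_natCast, chainTerm, sum_Icc_one, ← prod_pow_eq_pow_sum,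
    ← prod_pow_eq_pow_sum, ← prod_mul_distrib]
  congr 1
  refine prod_congr rfl fun j _ => ?_
  rw [bigWeight]
  split_ifs <;> ring

theorem summable_bigWeight {q : ℂ} (hq : ‖q‖ < 1) (x : ℂ) (e j : ℕ) :
    Summable fun n => ‖bigWeight x q e j n‖ := by
  refine Summable.of_nonneg_of_le (fun _ => norm_nonneg _) (fun n => ?_)
    (summable_norm_pow_mul_pow_choose hq x)
  have h : ‖q ^ n‖ ≤ 1 := by rw [norm_pow]; exact pow_le_one₀ (norm_nonneg _) hq.le
  unfold bigWeight
  split_ifs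
  · rw [pow_add, ← mul_assoc, norm_mul]; exact mul_le_of_le_one_right (norm_nonneg _) h
  · rw [norm_mul]; exact mul_le_of_le_one_right (norm_nonneg _) h
  · rw [mul_one]

theorem summable_multiWeight {q : ℂ} (hq : ‖q‖ < 1) (a : ℂ) (e j : ℕ) :
    Summable fun n => ‖multiWeight a q e j n‖ := by
  refine Summable.of_nonneg_of_le (fun _ => norm_nonneg _) (fun n => ?_)
    (summable_norm_pow_mul_pow_choose hq a)
  have h : ∀ n, ‖q ^ n‖ ≤ 1 := fun n => by
    rw [norm_pow]; exact pow_le_one₀ (norm_nonneg _) hq.le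
  rw [multiWeight, ← choose_two_add_choose_two_add n, add_assoc, pow_add q, ← mul_assoc, mul_assoc,
    norm_mul]
  refine mul_le_of_le_one_right (norm_nonneg _) ?_
  rw [norm_mul]
  refine mul_le_one₀ (h _) (norm_nonneg _) ?_
  split_ifs
  · exact h n
  · simp

/-! ### Passage to the limit -/

open Filter Topology

/-- Both sides are limits of the same sequence, (q;q)_L times the (2k-2)-fold iterate at L, so they
agree by uniqueness of limits. -/
theorem tsum_bigTerm_eq {a x q : ℂ} (hx : x ^ 2 = a) (hq : ‖q‖ < 1)
    (ha : ∀ n : ℕ, 1 ≤ n → a * q ^ n ≠ 1) {m e : ℕ} (he : e ≤ m) :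
    Summable (bigTerm x q (m + 1) (e + 1)) ∧
      qPochInf (-x * q) q / qPochInf (a * q) q * ∑' n, singleTerm a x q (m + 1) (e + 1) n
        = ∑' s : Fin (2 * (m + 1) - 2) → ℕ, bigTerm x q (m + 1) (e + 1) s := by
  have hw := summable_bigWeight hq x e
  simp only [funext (bigTerm_eq x q (m + 1) e)]
  refine ⟨(summable_chainTerm hq _ _ hw).of_norm, ?_⟩
  have h1 := tendsto_chainIter hq (m := 2 * (m + 1) - 2) hw
  have h2 := (tendsto_qPoch hq (-x * q)).mul (tendsto_chainIter_multiWeight hx hq ha he)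
  rw [← mul_assoc, mul_one_div] at h2
  refine tendsto_nhds_unique h2 (h1.congr fun L => ?_)
  rw [show 2 * (m + 1) - 2 = 2 * m by omega, chainIter_bigWeight hx hq ha]
  ring

theorem tsum_multiTerm_eq {a x q : ℂ} (hx : x ^ 2 = a) (hq : ‖q‖ < 1)
    (ha : ∀ n : ℕ, 1 ≤ n → a * q ^ n ≠ 1) {p e : ℕ} (he : e ≤ p + 1) :
    Summable (multiTerm a x q (p + 2) (e + 1)) ∧
      1 / qPochInf (a * q) q * ∑' n, singleTerm a x q (p + 2) (e + 1) n
        = ∑' s : Fin (p + 2 - 1) → ℕ, multiTerm a x q (p + 2) (e + 1) s := by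
  obtain ⟨C, hC, h⟩ := exists_norm_le_of_tendsto
    (tendsto_one_div_qPoch hq (neg_mul_pow_ne_one hx ha))
  set w : ℕ → ℕ → ℂ := fun j n => if j = p then multiWeight a q e j n * (1 / qPoch (-x * q) q n)
    else multiWeight a q e j n with hw_def
  have hw : ∀ j, Summable fun n => ‖w j n‖ := by
    intro j
    by_cases hj : j = p
    · simp only [hw_def, hj, if_true]
      refine Summable.of_nonneg_of_le (fun _ => norm_nonneg _) (fun n => ?_)
        ((summable_multiWeight hq a e p).mul_right C)
      rw [norm_mul]
      exact mul_le_mul_of_nonneg_left (h n) (norm_nonneg _)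
    · simp only [hw_def, hj, if_false]
      exact summable_multiWeight hq a e j
  have hfun : multiTerm a x q (p + 2) (e + 1) = fun s : Fin (p + 1) → ℕ => chainTerm q w s :=
    funext (multiTerm_eq a x q p e)
  rw [hfun]
  refine ⟨(summable_chainTerm hq _ _ hw).of_norm, ?_⟩
  refine tendsto_nhds_unique (tendsto_chainIter_multiWeight hx hq ha he)
    ((tendsto_chainIter hq (m := p + 1) hw).congr fun L => ?_)
  rw [← chainIter_mul_seed]
  rfl

end CompanionMelzer

theorem theorem5p2 (a x q : ℂ) (hx : x ^ 2 = a) (hq : ‖q‖ < 1)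
    (ha : ∀ n : ℕ, 1 ≤ n → a * q ^ n ≠ 1) (k i : ℕ) (hi : 1 ≤ i) (hik : i ≤ k) :
    (Summable (CompanionMelzer.singleTerm a x q k i) ∧
      Summable (CompanionMelzer.bigTerm x q k i) ∧
      CompanionMelzer.qPochInf (-x * q) q / CompanionMelzer.qPochInf (a * q) q
          * ∑' n : ℕ, CompanionMelzer.singleTerm a x q k i n
        = ∑' s : Fin (2 * k - 2) → ℕ, CompanionMelzer.bigTerm x q k i s) ∧
    (2 ≤ k →
      Summable (CompanionMelzer.multiTerm a x q k i) ∧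
      CompanionMelzer.qPochInf (-x * q) q / CompanionMelzer.qPochInf (a * q) q
          * ∑' n : ℕ, CompanionMelzer.singleTerm a x q k i n
        = CompanionMelzer.qPochInf (-x * q) q
          * ∑' s : Fin (k - 1) → ℕ, CompanionMelzer.multiTerm a x q k i s) := by
  obtain ⟨e, rfl⟩ : ∃ e, i = e + 1 := ⟨i - 1, by omega⟩
  obtain ⟨m, rfl⟩ : ∃ m, k = m + 1 := ⟨k - 1, by omega⟩
  refine ⟨⟨CompanionMelzer.summable_singleTerm hx hq m e,
    CompanionMelzer.tsum_bigTerm_eq hx hq ha (by omega)⟩, fun hk => ?_⟩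
  obtain ⟨p, rfl⟩ : ∃ p, m = p + 1 := ⟨m - 1, by omega⟩
  obtain ⟨h1, h2⟩ := CompanionMelzer.tsum_multiTerm_eq hx hq ha (p := p) (e := e) (by omega)
  refine ⟨h1, ?_⟩
  rw [← h2]
  ring
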